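/- \textbf{Protocols.} For $K,d\in\mathbb N$, a $K$-round SecAgg-compatible protocol $\mathcal A$ consists of finite fields $\mathcal O_1,\dots,\mathcal O_K$, encoding schemes $\mathcal E_t:\prod_{j<t}\mathcal O_j\times\mathbb R^d\to\mathcal O_t$ ($1\le t\le K$) and a decoding scheme $\mathcal U:\prod_{t\le K}\mathcal O_t\to\mathbb R^d$. These may be randomized: the encoding schemes may use public coins shared by all clients and the server, and private coins, i.i.d. over the clients; the decoding scheme may use the public coins and private coins of the server; all coins are independent of the data. On a dataset $D=(z_1,\dots,z_n)\in(\mathbb R^d)^n$ the aggregates are defined recursively by $O_t=\sum_{i=1}^n\mathcal E_t\big((O_j)_{j<t},z_i\big)$ (sum in $\mathcal O_t$), the output is $\mathcal A(D)=\mathcal U(O_1,\dots,O_K)$, and the total per-client communication is $\sum_{t=1}^K\log_2|\mathcal O_t|$ bits. For $G>0$ and $M\in[0,1]$ let $\mathcal P_1(d,G,M)$ be the set of probability distributions $\mathcal D$ on $\mathbb R^d$ with $\|z\|\le G$ for almost every $z\sim\mathcal D$ and with mean $\mu(\mathcal D)$ satisfying $\|\mu(\mathcal D)\|\le MG$ (Euclidean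 norms). \textbf{Statement.} For every $C>0$ there is $c>0$, depending only on $C$, such that the following holds for all $K,d,n\in\mathbb N$ with $n\ge1$, all $M\in[0,1]$, $G>0$, $\varepsilon>0$, $\delta\in(0,1)$ and every $K$-round SecAgg-compatible protocol $\mathcal A$. Suppose that for every $\mathcal D\in\mathcal P_1(d,G,M)$, with expectations over $D\sim\mathcal D^n$ and the coins, $$\mathbb E[\mathcal A(D)]=\mu(\mathcal D)\quad\text{and}\quad \mathbb E\,\|\mathcal A(D)-\mu(\mathcal D)\|^2\le C\min\Big(M^2G^2,\ \frac{G^2}{n}+\frac{G^2d\log(1/\delta)}{n^2\varepsilon^2}\Big).$$ Then there is a distribution $\mathcal D\in\mathcal P_1(d,G,M)$ such that on $D\sim\mathcal D^n$, with probability $1$, the total per-client communication of $\mathcal A$ is at least $$c\,\min\Big(d,\ \frac{M^2n^2\varepsilon^2}{\log(1/\delta)},\ M^2nd\Big)\ \text{bits}.$$ -/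

import Mathlib

open MeasureTheory
open scoped ENNReal

/-- A `K`-round SecAgg-compatible protocol for vectors in `ℝ^d`.

`Pub`, `Priv`, `Srv` are the probability spaces of the public coins (shared by all clients and the
server), of the private coins of one client, and of the private coins of the server.
`O t` is the finite field over which secure aggregation operates in round `t`.
The encoding scheme of round `t` maps the aggregates of the earlier rounds and a data vector to a
message in `O t`; the decoding scheme maps the aggregates of all rounds to an estimate. -/
structure SecAggProtocol.{u, v, w} (K d : ℕ) where
  Pub : Type u
  Priv : Type v
  Srv : Type w
  [measPub : MeasurableSpace Pub]
  [measPriv : MeasurableSpace Priv]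
  [measSrv : MeasurableSpace Srv]
  pubLaw : Measure Pub
  privLaw : Measure Priv
  srvLaw : Measure Srv
  [probPub : IsProbabilityMeasure pubLaw]
  [probPriv : IsProbabilityMeasure privLaw]
  [probSrv : IsProbabilityMeasure srvLaw]
  O : Fin K → Type
  [field : ∀ t, Field (O t)]
  [finite : ∀ t, Finite (O t)]
  encode : (t : Fin K) → Pub → Priv → ((j : {j : Fin K // j < t}) → O j.1) →
    EuclideanSpace ℝ (Fin d) → O t
  decode : Pub → Srv → ((t : Fin K) → O t) → EuclideanSpace ℝ (Fin d)
  measurable_encode : ∀ (t : Fin K) (h : (j : {j : Fin K // j < t}) → O j.1) (o : O t),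
    MeasurableSet {p : Pub × Priv × EuclideanSpace ℝ (Fin d) | encode t p.1 p.2.1 h p.2.2 = o}
  measurable_decode : ∀ o : (t : Fin K) → O t,
    Measurable fun p : Pub × Srv => decode p.1 p.2 o

namespace SecAggProtocol

attribute [instance] measPub measPriv measSrv probPub probPriv probSrv field finite

variable {K d : ℕ}

/-- All the coins used by a run with `n` clients. -/
abbrev Coins (A : SecAggProtocol K d) (n : ℕ) := A.Pub × (Fin n → A.Priv) × A.Srv

/-- The public coins, the private coins of the `n` clients and the server's coins are independent,
and the clients' coins are identically distributed. -/
noncomputable def coinLaw (A : SecAggProtocol K d) (n : ℕ) : Measure (A.Coins n) :=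
  A.pubLaw.prod ((Measure.pi fun _ : Fin n => A.privLaw).prod A.srvLaw)

/-- The output `O_t` of secure aggregation in round `t`: the sum, in the finite field, of the
messages of the clients, each encoded from the previous aggregates and the client's own vector. -/
noncomputable def aggregate (A : SecAggProtocol K d) {n : ℕ} (ω : A.Coins n)
    (z : Fin n → EuclideanSpace ℝ (Fin d)) (t : Fin K) : A.O t :=
  ∑ i : Fin n, A.encode t ω.1 (ω.2.1 i) (fun j => aggregate A ω z j.1) (z i)
termination_by t.val
decreasing_by exact j.2

/-- The output of the protocol on the dataset `z` with coins `ω`. -/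
noncomputable def output (A : SecAggProtocol K d) {n : ℕ} (ω : A.Coins n)
    (z : Fin n → EuclideanSpace ℝ (Fin d)) : EuclideanSpace ℝ (Fin d) :=
  A.decode ω.1 ω.2.2 (A.aggregate ω z)

/-- Number of bits `b_t = log₂ |O_t|` of a message in round `t`. -/
noncomputable def roundBits (A : SecAggProtocol K d) (t : Fin K) : ℝ :=
  Real.logb 2 (Nat.card (A.O t))

/-- Total per-client communication, in bits. -/
noncomputable def totalBits (A : SecAggProtocol K d) : ℝ :=
  ∑ t, A.roundBits t

end SecAggProtocol

/-- The population mean. -/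
noncomputable def popMean {d : ℕ} (D : ProbabilityMeasure (EuclideanSpace ℝ (Fin d))) :
    EuclideanSpace ℝ (Fin d) :=
  ∫ z, z ∂(D : Measure (EuclideanSpace ℝ (Fin d)))

/-- The distributions on `ℝ^d` that are supported in the ball of radius `G` and whose mean has norm
at most `M G`. -/
def boundedMeanClass (d : ℕ) (G M : ℝ) : Set (ProbabilityMeasure (EuclideanSpace ℝ (Fin d))) :=
  {D | (∀ᵐ z ∂(D : Measure (EuclideanSpace ℝ (Fin d))), ‖z‖ ≤ G) ∧ ‖popMean D‖ ≤ M * G}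

/-- The law `D^n` of a dataset of `n` i.i.d. vectors. -/
noncomputable def dataLaw {d : ℕ} (D : ProbabilityMeasure (EuclideanSpace ℝ (Fin d))) (n : ℕ) :
    Measure (Fin n → EuclideanSpace ℝ (Fin d)) :=
  Measure.pi fun _ : Fin n => (D : Measure (EuclideanSpace ℝ (Fin d)))

namespace SecAggProtocol

variable {K d : ℕ}

/-- The joint law of coins and dataset, the coins being independent of the data. -/
noncomputable def runLaw (A : SecAggProtocol K d) (n : ℕ)
    (D : ProbabilityMeasure (EuclideanSpace ℝ (Fin d))) :
    Measure (A.Coins n × (Fin n → EuclideanSpace ℝ (Fin d))) :=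
  (A.coinLaw n).prod (dataLaw D n)

/-- With `n` clients, the output is an unbiased estimate of the mean of each distribution in `P`. -/
def IsUnbiasedOn (A : SecAggProtocol K d) (n : ℕ)
    (P : Set (ProbabilityMeasure (EuclideanSpace ℝ (Fin d)))) : Prop :=
  ∀ D ∈ P, Integrable (fun x => A.output x.1 x.2) (A.runLaw n D) ∧
    ∫ x, A.output x.1 x.2 ∂(A.runLaw n D) = popMean D

/-- The mean squared error on `n` i.i.d. samples of `D`, over coins and data. -/
noncomputable def meanSqError (A : SecAggProtocol K d) (n : ℕ)
    (D : ProbabilityMeasure (EuclideanSpace ℝ (Fin d))) : ℝ≥0∞ :=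
  ∫⁻ x, ENNReal.ofReal (‖A.output x.1 x.2 - popMean D‖ ^ 2) ∂(A.runLaw n D)

end SecAggProtocol

/-! Test the protocol on constant datasets: every client holds `a • s`, with `s` a uniform sign
vector and `a` scaled so that `‖a • s‖ = M G`. Unbiasedness makes the output `X` correlate with `s`,
as `E⟪s, X⟫ = a d`, while the error bound `C M² G²` keeps `E‖X‖²` of order `M² G²`. For fixed coins
`X` depends on `s` only through the transcript, so it takes at most `N = ∏ |O_t|` values. Since `E
exp(⟪w, s⟫ - ‖w‖²/2) ≤ 1` for every fixed `w`, a union over the `N` values gives `E[⟪W, s⟫ - ‖W‖²/2]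
≤ log N` for `W = l X` (`sum_inner_message_le`). Averaging over the coins (`le_log_card_transcript`)
and optimizing `l` gives `log N ≥ d / (4 (C + 1))`, which dominates the required minimum. -/

/-- The vertex `(±1)_i` of the hypercube in `ℝ^d` with sign pattern `s`. -/
noncomputable def cubeVertex {d : ℕ} (s : Fin d → Bool) : EuclideanSpace ℝ (Fin d) :=
  WithLp.toLp 2 fun i => if s i then 1 else -1

theorem norm_cubeVertex_sq {d : ℕ} (s : Fin d → Bool) : ‖cubeVertex s‖ ^ 2 = d := by
  rw [EuclideanSpace.real_norm_sq_eq]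
  have h : ∀ i, (cubeVertex s i) ^ 2 = 1 := fun i => by
    by_cases hs : s i <;> simp [cubeVertex, hs]
  simp [h]

theorem inner_cubeVertex {d : ℕ} (w : EuclideanSpace ℝ (Fin d)) (s : Fin d → Bool) :
    inner ℝ w (cubeVertex s) = ∑ i, if s i then w i else -w i := by
  rw [PiLp.inner_apply]
  refine Finset.sum_congr rfl fun i _ => ?_
  by_cases hs : s i <;> simp [cubeVertex, hs]

/-- A uniformly random vertex of the hypercube is sub-Gaussian. -/
theorem sum_exp_inner_cubeVertex_le {d : ℕ} (w : EuclideanSpace ℝ (Fin d)) :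
    ∑ s : Fin d → Bool, Real.exp (inner ℝ w (cubeVertex s) - ‖w‖ ^ 2 / 2) ≤ 2 ^ d := by
  -- The signs are independent, so the moment generating function factors over coordinates.
  have key : ∑ s : Fin d → Bool, Real.exp (inner ℝ w (cubeVertex s)) =
      ∏ i, (2 * Real.cosh (w i)) := by
    have h : ∀ i, 2 * Real.cosh (w i) =
        ∑ b ∈ (Finset.univ : Finset Bool), Real.exp (if b then w i else -w i) := fun i => by
      simp [Real.cosh_eq]
      ring
    simp_rw [h]
    rw [Finset.prod_univ_sum, Fintype.piFinset_univ]
    refine Finset.sum_congr rfl fun s _ => ?_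
    rw [inner_cubeVertex, Real.exp_sum]
  have hle : ∏ i, (2 * Real.cosh (w i)) ≤ 2 ^ d * Real.exp (‖w‖ ^ 2 / 2) := by
    calc ∏ i, (2 * Real.cosh (w i)) ≤ ∏ i, (2 * Real.exp (w i ^ 2 / 2)) :=
          Finset.prod_le_prod (fun i _ => by positivity) fun i _ =>
            mul_le_mul_of_nonneg_left (Real.cosh_le_exp_half_sq _) zero_le_two
      _ = 2 ^ d * Real.exp (‖w‖ ^ 2 / 2) := by
          rw [Finset.prod_mul_distrib, ← Real.exp_sum, EuclideanSpace.real_norm_sq_eq,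
            Finset.sum_div]
          simp
  simp_rw [Real.exp_sub]
  rw [← Finset.sum_div, key, div_le_iff₀ (Real.exp_pos _)]
  exact hle

/-- A function of a uniformly random hypercube vertex that factors through a message space `T`
correlates with the vertex by at most `log |T|`, up to its own second moment. -/
theorem sum_inner_message_le {d : ℕ} {T : Type*} [Finite T] [Nonempty T]
    (f : (Fin d → Bool) → T) (W : T → EuclideanSpace ℝ (Fin d)) :
    ∑ s, (inner ℝ (W (f s)) (cubeVertex s) - ‖W (f s)‖ ^ 2 / 2) ≤
      2 ^ d * Real.log (Nat.card T) := by
  have := Fintype.ofFinite T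
  have hN : (0 : ℝ) < Nat.card T := by exact_mod_cast Nat.card_pos
  set g : T → (Fin d → Bool) → ℝ := fun t s => inner ℝ (W t) (cubeVertex s) - ‖W t‖ ^ 2 / 2
  -- `x + 1 ≤ exp x` at `x = g - log |T|` stands in for Jensen. Summing over all messages removes
  -- the dependence on `f`.
  have hpt : ∀ s, g (f s) s ≤
      Real.log (Nat.card T) - 1 + (∑ t, Real.exp (g t s)) / Nat.card T := fun s => by
    have h1 := Real.add_one_le_exp (g (f s) s - Real.log (Nat.card T))
    rw [Real.exp_sub, Real.exp_log hN] at h1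
    have h2 : Real.exp (g (f s) s) / Nat.card T ≤ (∑ t, Real.exp (g t s)) / Nat.card T := by
      gcongr
      exact Finset.single_le_sum (f := fun t => Real.exp (g t s))
        (fun t _ => (Real.exp_pos _).le) (Finset.mem_univ _)
    linarith
  have hexp : ∑ s, ∑ t, Real.exp (g t s) ≤ Nat.card T * 2 ^ d := by
    rw [Finset.sum_comm]
    calc ∑ t, ∑ s, Real.exp (g t s) ≤ ∑ _t : T, (2 : ℝ) ^ d :=
          Finset.sum_le_sum fun t _ => sum_exp_inner_cubeVertex_le (W t)
      _ = Nat.card T * 2 ^ d := by simp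
  calc ∑ s, g (f s) s
      ≤ ∑ s, (Real.log (Nat.card T) - 1 + (∑ t, Real.exp (g t s)) / Nat.card T) :=
        Finset.sum_le_sum fun s _ => hpt s
    _ = 2 ^ d * (Real.log (Nat.card T) - 1) + (∑ s, ∑ t, Real.exp (g t s)) / Nat.card T := by
        rw [Finset.sum_add_distrib, ← Finset.sum_div]
        simp
        ring
    -- Each message contributes at most `2 ^ d`, so the average over messages cancels the `-1`.
    _ ≤ 2 ^ d * (Real.log (Nat.card T) - 1) + 2 ^ d := by
        gcongr
        rw [div_le_iff₀ hN]
        linarith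
    _ = 2 ^ d * Real.log (Nat.card T) := by ring

/-! ### Protocols on constant datasets -/

/-- The point mass at `v`. -/
noncomputable def pointMass {d : ℕ} (v : EuclideanSpace ℝ (Fin d)) :
    ProbabilityMeasure (EuclideanSpace ℝ (Fin d)) :=
  ⟨Measure.dirac v, inferInstance⟩

theorem popMean_pointMass {d : ℕ} (v : EuclideanSpace ℝ (Fin d)) :
    popMean (pointMass v) = v := by
  simp [popMean, pointMass]

theorem pointMass_mem_boundedMeanClass {d : ℕ} {G M : ℝ} (hG : 0 ≤ G) (hM : M ≤ 1)
    {v : EuclideanSpace ℝ (Fin d)} (hv : ‖v‖ ≤ M * G) :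
    pointMass v ∈ boundedMeanClass d G M := by
  refine ⟨?_, by rwa [popMean_pointMass]⟩
  have h : ‖v‖ ≤ G := hv.trans (mul_le_of_le_one_left hG hM)
  simpa [pointMass, ae_dirac_eq] using h

theorem dataLaw_pointMass {d : ℕ} (v : EuclideanSpace ℝ (Fin d)) (n : ℕ) :
    dataLaw (pointMass v) n = Measure.dirac fun _ => v := by
  refine Measure.pi_eq fun s hs => ?_
  simp only [pointMass, ProbabilityMeasure.coe_mk]
  rw [Measure.dirac_apply' _ (MeasurableSet.univ_pi hs)]
  simp_rw [Measure.dirac_apply' v (hs _)]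
  by_cases h : ∀ i, v ∈ s i
  · simp [h]
  · have h' := h
    push Not at h'
    obtain ⟨i, hi⟩ := h'
    rw [Finset.prod_eq_zero (Finset.mem_univ i) (by simp [hi])]
    simp [h]

namespace SecAggProtocol

variable {K d : ℕ}

instance (A : SecAggProtocol K d) (n : ℕ) : IsProbabilityMeasure (A.coinLaw n) := by
  unfold coinLaw
  infer_instance

theorem runLaw_pointMass (A : SecAggProtocol K d) (n : ℕ) (v : EuclideanSpace ℝ (Fin d)) :
    A.runLaw n (pointMass v) = (A.coinLaw n).map fun ω => (ω, fun _ => v) := by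
  rw [runLaw, dataLaw_pointMass, Measure.prod_dirac]

/-- Transcripts form the product of the message spaces, so bits add up to the logarithm of their
number. -/
theorem totalBits_mul_log_two (A : SecAggProtocol K d) :
    A.totalBits * Real.log 2 = Real.log (Nat.card (∀ t, A.O t)) := by
  have h2 : Real.log 2 ≠ 0 := (Real.log_pos one_lt_two).ne'
  rw [Nat.card_pi, Nat.cast_prod, Real.log_prod fun t _ => by
    exact_mod_cast Nat.card_pos.ne', totalBits, Finset.sum_mul]
  exact Finset.sum_congr rfl fun t _ => div_mul_cancel₀ _ h2

theorem totalBits_nonneg (A : SecAggProtocol K d) : 0 ≤ A.totalBits :=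
  Finset.sum_nonneg fun _ _ =>
    Real.logb_nonneg one_lt_two (by exact_mod_cast Nat.card_pos)

/-- If every client holds the same vector `v`, an unbiased output has mean `v` over the coins. -/
theorem IsUnbiasedOn.pointMass {A : SecAggProtocol K d} {n : ℕ}
    {P : Set (ProbabilityMeasure (EuclideanSpace ℝ (Fin d)))} (hA : A.IsUnbiasedOn n P)
    {v : EuclideanSpace ℝ (Fin d)} (hv : pointMass v ∈ P) :
    Integrable (fun ω => A.output ω fun _ => v) (A.coinLaw n) ∧
      ∫ ω, A.output ω (fun _ => v) ∂A.coinLaw n = v := by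
  obtain ⟨hi, he⟩ := hA _ hv
  rw [runLaw_pointMass] at hi he
  have hm : AEMeasurable (fun ω : A.Coins n => (ω, fun _ : Fin n => v)) (A.coinLaw n) := by
    fun_prop
  rw [integral_map hm hi.aestronglyMeasurable, popMean_pointMass] at he
  exact ⟨hi.comp_aemeasurable hm, he⟩

/-- If every client holds the same vector `v`, a bound on the mean squared error bounds the second
moment of the output. -/
theorem integral_norm_output_sq_le {A : SecAggProtocol K d} {n : ℕ}
    {P : Set (ProbabilityMeasure (EuclideanSpace ℝ (Fin d)))} (hA : A.IsUnbiasedOn n P)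
    {v : EuclideanSpace ℝ (Fin d)} (hv : pointMass v ∈ P) {B : ℝ} (hB : 0 ≤ B)
    (hE : A.meanSqError n (pointMass v) ≤ ENNReal.ofReal B) :
    Integrable (fun ω => ‖A.output ω fun _ => v‖ ^ 2) (A.coinLaw n) ∧
      ∫ ω, ‖A.output ω (fun _ => v)‖ ^ 2 ∂A.coinLaw n ≤ 2 * (B + ‖v‖ ^ 2) := by
  have hi := (hA _ hv).1
  obtain ⟨hi', -⟩ := hA.pointMass hv
  rw [meanSqError, runLaw_pointMass, popMean_pointMass] at hE
  rw [runLaw_pointMass] at hi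
  have hm : AEMeasurable (fun ω : A.Coins n => (ω, fun _ : Fin n => v)) (A.coinLaw n) := by
    fun_prop
  have hae : AEStronglyMeasurable (fun x : A.Coins n × (Fin n → EuclideanSpace ℝ (Fin d)) =>
      ‖A.output x.1 x.2 - v‖ ^ 2) ((A.coinLaw n).map fun ω => (ω, fun _ : Fin n => v)) :=
    (hi.aestronglyMeasurable.sub aestronglyMeasurable_const).norm.pow 2
  rw [lintegral_map' hae.aemeasurable.ennreal_ofReal hm] at hE
  have hsq : AEStronglyMeasurable (fun ω => ‖A.output ω (fun _ => v) - v‖ ^ 2) (A.coinLaw n) :=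
    (hi'.aestronglyMeasurable.sub aestronglyMeasurable_const).norm.pow 2
  have hnn : 0 ≤ᵐ[A.coinLaw n] fun ω => ‖A.output ω (fun _ => v) - v‖ ^ 2 :=
    Filter.Eventually.of_forall fun ω => by positivity
  have hint : Integrable (fun ω => ‖A.output ω (fun _ => v) - v‖ ^ 2) (A.coinLaw n) :=
    ⟨hsq, (hasFiniteIntegral_iff_ofReal hnn).2 (hE.trans_lt ENNReal.ofReal_lt_top)⟩
  have hle : ∫ ω, ‖A.output ω (fun _ => v) - v‖ ^ 2 ∂A.coinLaw n ≤ B := by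
    rw [integral_eq_lintegral_of_nonneg_ae hnn hsq]
    exact ENNReal.toReal_le_of_le_ofReal hB hE
  -- `(x + y)² ≤ 2 (x² + y²)` costs a factor 2, which only affects the final constant.
  have hpt : ∀ ω, ‖A.output ω (fun _ : Fin n => v)‖ ^ 2 ≤
      2 * (‖A.output ω (fun _ => v) - v‖ ^ 2 + ‖v‖ ^ 2) := fun ω => by
    have h := norm_add_le (A.output ω (fun _ : Fin n => v) - v) v
    rw [sub_add_cancel] at h
    calc _ ≤ _ := pow_le_pow_left₀ (norm_nonneg _) h 2
      _ ≤ _ := add_sq_le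
  have hdom : Integrable (fun ω => 2 * (‖A.output ω (fun _ => v) - v‖ ^ 2 + ‖v‖ ^ 2))
      (A.coinLaw n) := (hint.add (integrable_const _)).const_mul 2
  have hout : Integrable (fun ω => ‖A.output ω fun _ => v‖ ^ 2) (A.coinLaw n) :=
    hdom.mono' (hi'.aestronglyMeasurable.norm.pow 2)
      (Filter.Eventually.of_forall fun ω => by
        rw [Real.norm_of_nonneg (by positivity)]
        exact hpt ω)
  refine ⟨hout, (integral_mono hout hdom hpt).trans ?_⟩
  rw [integral_const_mul, integral_add hint (integrable_const _)]
  simp only [integral_const, probReal_univ, one_smul]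
  linarith

/-! ### From correlation to communication -/

/-- If on the constant datasets `z_i = a x`, `x ∈ {±1}^d`, the output is unbiased with second moment
at most `B`, then the transcript must be long. -/
theorem le_log_card_transcript (A : SecAggProtocol K d) (n : ℕ) {a B l : ℝ}
    (hmean : ∀ s, Integrable (fun ω => A.output ω fun _ => a • cubeVertex s) (A.coinLaw n) ∧
      ∫ ω, A.output ω (fun _ => a • cubeVertex s) ∂A.coinLaw n = a • cubeVertex s)
    (hsq : ∀ s, Integrable (fun ω => ‖A.output ω fun _ => a • cubeVertex s‖ ^ 2) (A.coinLaw n) ∧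
      ∫ ω, ‖A.output ω (fun _ => a • cubeVertex s)‖ ^ 2 ∂A.coinLaw n ≤ B) :
    l * (a * d) - l ^ 2 * B / 2 ≤ Real.log (Nat.card (∀ t, A.O t)) := by
  set X : (Fin d → Bool) → A.Coins n → EuclideanSpace ℝ (Fin d) :=
    fun s ω => A.output ω fun _ => a • cubeVertex s
  have hint : ∀ s, Integrable (fun ω => l * inner ℝ (cubeVertex s) (X s ω) -
      l ^ 2 / 2 * ‖X s ω‖ ^ 2) (A.coinLaw n) := fun s =>
    (((hmean s).1.const_inner _).const_mul l).sub ((hsq s).1.const_mul _)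
  -- Unbiasedness turns the mean inner product into `a ‖s‖² = a d`.
  have hlow : ∀ s, l * (a * d) - l ^ 2 * B / 2 ≤
      ∫ ω, (l * inner ℝ (cubeVertex s) (X s ω) - l ^ 2 / 2 * ‖X s ω‖ ^ 2) ∂A.coinLaw n :=
    fun s => by
      rw [integral_sub (((hmean s).1.const_inner _).const_mul l) ((hsq s).1.const_mul _),
        integral_const_mul, integral_const_mul, integral_inner (hmean s).1, (hmean s).2,
        inner_smul_right, real_inner_self_eq_norm_sq, norm_cubeVertex_sq]
      have := mul_le_mul_of_nonneg_left (hsq s).2 (by positivity : 0 ≤ l ^ 2 / 2)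
      linarith
  -- With the coins fixed, the transcript is a deterministic function of `s`; the scale `l` is
  -- absorbed into the decoder.
  have hup : ∀ ω, ∑ s, (l * inner ℝ (cubeVertex s) (X s ω) - l ^ 2 / 2 * ‖X s ω‖ ^ 2) ≤
      2 ^ d * Real.log (Nat.card (∀ t, A.O t)) := fun ω => by
    refine le_trans (le_of_eq ?_) (sum_inner_message_le
      (fun s => A.aggregate ω fun _ => a • cubeVertex s) (fun o => l • A.decode ω.1 ω.2.2 o))
    refine Finset.sum_congr rfl fun s _ => ?_
    rw [real_inner_smul_left, real_inner_comm, norm_smul, mul_pow, Real.norm_eq_abs, sq_abs]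
    simp only [X, output]
    ring
  have h : 2 ^ d * (l * (a * d) - l ^ 2 * B / 2) ≤
      2 ^ d * Real.log (Nat.card (∀ t, A.O t)) := by
    calc 2 ^ d * (l * (a * d) - l ^ 2 * B / 2)
        = ∑ _s : Fin d → Bool, (l * (a * d) - l ^ 2 * B / 2) := by simp; ring
      _ ≤ ∑ s, ∫ ω, (l * inner ℝ (cubeVertex s) (X s ω) - l ^ 2 / 2 * ‖X s ω‖ ^ 2)
            ∂A.coinLaw n := Finset.sum_le_sum fun s _ => hlow s
      _ = ∫ ω, ∑ s, (l * inner ℝ (cubeVertex s) (X s ω) - l ^ 2 / 2 * ‖X s ω‖ ^ 2)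
            ∂A.coinLaw n := (integral_finsetSum _ fun s _ => hint s).symm
      _ ≤ ∫ _ω, 2 ^ d * Real.log (Nat.card (∀ t, A.O t)) ∂A.coinLaw n :=
          integral_mono (integrable_finsetSum _ fun s _ => hint s) (integrable_const _) hup
      _ = 2 ^ d * Real.log (Nat.card (∀ t, A.O t)) := by simp
  exact le_of_mul_le_mul_left h (by positivity)

/-- An unbiased protocol whose squared error is of the order of the squared radius `(M G)²` of the
class of means needs a number of bits linear in the dimension. -/
theorem dimension_le_totalBits (A : SecAggProtocol K d) (n : ℕ) {C M G : ℝ} (hC : 0 < C)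
    (hM : 0 < M) (hM1 : M ≤ 1) (hG : 0 < G) (hd : 0 < d)
    (hA : A.IsUnbiasedOn n (boundedMeanClass d G M))
    (hE : ∀ D ∈ boundedMeanClass d G M,
      A.meanSqError n D ≤ ENNReal.ofReal (C * (M ^ 2 * G ^ 2))) :
    1 / (4 * (C + 1)) * d ≤ A.totalBits := by
  have hd' : (0 : ℝ) < d := by exact_mod_cast hd
  have hsd : 0 < √(d : ℝ) := Real.sqrt_pos.2 hd'
  have hdd : √(d : ℝ) ^ 2 = d := Real.sq_sqrt hd'.le
  set r := M * G with hr
  have hr0 : 0 < r := mul_pos hM hG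
  set a := r / √d with ha
  have hnorm : ∀ s : Fin d → Bool, ‖a • cubeVertex s‖ = r := fun s => by
    have h : ‖cubeVertex s‖ = √d := by
      rw [← norm_cubeVertex_sq s, Real.sqrt_sq (norm_nonneg _)]
    rw [norm_smul, h, Real.norm_of_nonneg (by positivity), ha, div_mul_cancel₀ _ hsd.ne']
  have hmem : ∀ s : Fin d → Bool, _root_.pointMass (a • cubeVertex s) ∈ boundedMeanClass d G M :=
    fun s => pointMass_mem_boundedMeanClass hG.le hM1 (hnorm s).le
  -- `l = a d / B` maximizes the quadratic `l a d - l² B / 2`, with value `a² d² / (2 B)`.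
  have hlog := A.le_log_card_transcript n (a := a) (B := 2 * (C * (M ^ 2 * G ^ 2) + r ^ 2))
    (l := √d / (2 * (C + 1) * r)) (fun s => hA.pointMass (hmem s)) fun s => by
      have h := integral_norm_output_sq_le hA (hmem s) (by positivity) (hE _ (hmem s))
      rwa [hnorm] at h
  have hval : √(d : ℝ) / (2 * (C + 1) * r) * (a * d) -
      (√(d : ℝ) / (2 * (C + 1) * r)) ^ 2 * (2 * (C * (M ^ 2 * G ^ 2) + r ^ 2)) / 2 =
        1 / (4 * (C + 1)) * d := by
    have h1 : C * (M ^ 2 * G ^ 2) + r ^ 2 = (C + 1) * r ^ 2 := by rw [hr]; ring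
    rw [h1, div_pow, hdd, ha]
    field_simp
    ring
  rw [hval, ← totalBits_mul_log_two] at hlog
  have hlog2 : Real.log 2 ≤ 1 := by linarith [Real.log_two_lt_d9]
  exact hlog.trans (mul_le_of_le_one_right A.totalBits_nonneg hlog2)

end SecAggProtocol

theorem mainTheorem4 (C : ℝ) (hC : 0 < C) :
    ∃ c : ℝ, 0 < c ∧
      ∀ (K d n : ℕ) (M G ε δ : ℝ), 1 ≤ n → 0 ≤ M → M ≤ 1 → 0 < G → 0 < ε → 0 < δ → δ < 1 →
      ∀ A : SecAggProtocol K d,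
        A.IsUnbiasedOn n (boundedMeanClass d G M) →
        (∀ D ∈ boundedMeanClass d G M,
          A.meanSqError n D ≤ ENNReal.ofReal (C * min (M ^ 2 * G ^ 2)
            (G ^ 2 / n + G ^ 2 * d * Real.log (1 / δ) / ((n : ℝ) ^ 2 * ε ^ 2)))) →
        ∃ D ∈ boundedMeanClass d G M, ∀ᵐ _z ∂(dataLaw D n),
          c * min (d : ℝ) (min (M ^ 2 * (n : ℝ) ^ 2 * ε ^ 2 / Real.log (1 / δ))
            (M ^ 2 * n * d)) ≤ A.totalBits := by
  have hc : 0 < 1 / (4 * (C + 1)) := by positivity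
  refine ⟨1 / (4 * (C + 1)), hc, ?_⟩
  intro K d n M G ε δ _ hM hM1 hG _ _ _ A hA hE
  -- The communication does not depend on the dataset, so the bound holds for every distribution.
  refine ⟨pointMass 0, pointMass_mem_boundedMeanClass hG.le hM1 (by simp; positivity),
    Filter.Eventually.of_forall fun _ => ?_⟩
  set R := min (M ^ 2 * (n : ℝ) ^ 2 * ε ^ 2 / Real.log (1 / δ)) (M ^ 2 * n * d) with hR
  by_cases h0 : 0 < M ∧ 0 < d
  · refine (mul_le_mul_of_nonneg_left (min_le_left _ _) hc.le).trans
      (A.dimension_le_totalBits n hC h0.1 hM1 hG h0.2 hA fun D hD => (hE D hD).trans ?_)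
    exact ENNReal.ofReal_le_ofReal (mul_le_mul_of_nonneg_left (min_le_left _ _) hC.le)
  -- If `M = 0` or `d = 0`, the scaling breaks down, but the term `M² n d` makes the claimed bound
  -- at most zero.
  · have hz : M ^ 2 * (n : ℝ) * d = 0 := by
      rcases hM.eq_or_lt with h | h
      · simp [← h]
      · have : d = 0 := by
          by_contra hd
          exact h0 ⟨h, Nat.pos_of_ne_zero hd⟩
        simp [this]
    have hle : min (d : ℝ) R ≤ 0 := (min_le_right _ _).trans ((min_le_right _ _).trans hz.le)
    exact (mul_nonpos_of_nonneg_of_nonpos hc.le hle).trans A.totalBits_nonneg
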